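/- Consider a sealed-bid first-price auction of one item with $n$ buyers $1,\dots,n$. Buyer $i$ has a private value drawn, independently of the others, from a commonly known distribution $G_i$ whose support is a finite set of nonnegative reals. A strategy of buyer $i$ assigns to each value $v$ in the support of $G_i$ a probability distribution $\sigma_i(v)$ of bids in $[0,v]$ (bids are nonnegative and no buyer overbids). Utilities are quasi-linear. A single highest bidder wins and pays his bid; if there are several highest bidders, a Vickrey auction is run among them (the one with the largest value wins and pays the largest value among the other highest bidders). A profile $\sigma=(\sigma_1,\dots,\sigma_n)$ is a Bayesian Nash equilibrium (BNE) if no buyer, at any value in the support of his distribution, can raise his expected utility by switching to another distribution of bids in $[0,v]$. Given $\sigma$, the smallest winning bid $\underline b$ is the infimum of the bids $b\ge 0$ such that every buyer would outbid all the others with positive probability by bidding $b$. Let $\sigma$ be a BNE. If two buyers $i,j$ have identical value distributions, $G_i=G_j$, then they have identical bidding strategies above the smallest winning bid: for every value $v$ in the support of $G_i$, $\sigma_i(v)(B)=\sigma_j(v)(B)$ for every Borel set $B\subseteq(\underline b,\infty)$, and $\sigma_i(v)=\sigma_j(v)$ whenever $v>\underline b$. In particular, if $G_1=\dots=G_n$,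 then the BNE is symmetric in this sense: the above holds for all pairs of buyers $i,j$. -/

import Mathlib

open MeasureTheory

/-- A (behaviour) strategy: to each private value, a probability distribution of bids. Only what it
prescribes at values that occur with positive probability matters below. -/
abbrev BidStrategy : Type := ℝ → ProbabilityMeasure ℝ

/-- Joint law of (private value, bid) of a buyer whose value has distribution `G` and who
plays the strategy `s`. -/
noncomputable def valueBidLaw (G : PMF ℝ) (s : BidStrategy) : Measure (ℝ × ℝ) :=
  Measure.sum fun v : G.support =>
    G (v : ℝ) • ((s (v : ℝ) : Measure ℝ).map fun b => ((v : ℝ), b))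

/-- Joint law of the profile of all (value, bid) pairs; the buyers are independent. -/
noncomputable def profileLaw {n : ℕ} (G : Fin n → PMF ℝ) (σ : Fin n → BidStrategy) :
    Measure (Fin n → ℝ × ℝ) :=
  Measure.pi fun i => valueBidLaw (G i) (σ i)

open Classical in
/-- Ex post utility of buyer `i` with value `v` who bids `b`, when every other buyer `j` has value
`(θ j).1` and bids `(θ j).2` (the entry `θ i` plays no role).
A single highest bidder wins and pays his bid. Several highest bidders take part in a Vickrey
auction: the one with the largest value wins and pays the largest value among the other
highest bidders. (If the largest value is attained twice, the utility is `0` whoever wins.) -/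
noncomputable def exPostUtility {n : ℕ} (i : Fin n) (v b : ℝ) (θ : Fin n → ℝ × ℝ) : ℝ :=
  if ∀ j, j ≠ i → (θ j).2 < b then v - b
  else if ∀ j, j ≠ i → (θ j).2 ≤ b then
    max 0 (v - sSup ((fun j => (θ j).1) '' {j | j ≠ i ∧ (θ j).2 = b}))
  else 0

/-- Expected utility of buyer `i` with value `v` who draws his bid from `τ`, when the other buyers
follow `σ`. -/
noncomputable def interimUtility {n : ℕ} (G : Fin n → PMF ℝ) (σ : Fin n → BidStrategy)
    (i : Fin n) (v : ℝ) (τ : ProbabilityMeasure ℝ) : ℝ :=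
  ∫ b, ∫ θ, exPostUtility i v b θ ∂(profileLaw G σ) ∂(τ : Measure ℝ)

/-- A distribution of bids is admissible at value `v` if the bids are nonnegative and
never exceed `v` (no overbidding). -/
def AdmissibleBid (v : ℝ) (τ : ProbabilityMeasure ℝ) : Prop :=
  ∀ᵐ b ∂(τ : Measure ℝ), 0 ≤ b ∧ b ≤ v

/-- Bayesian Nash equilibrium of the first-price auction. -/
structure IsBNE {n : ℕ} (G : Fin n → PMF ℝ) (σ : Fin n → BidStrategy) : Prop where
  admissible : ∀ i, ∀ v ∈ (G i).support, AdmissibleBid v (σ i v)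
  best_response : ∀ i, ∀ v ∈ (G i).support, ∀ τ : ProbabilityMeasure ℝ, AdmissibleBid v τ →
    interimUtility G σ i v τ ≤ interimUtility G σ i v (σ i v)

/-- The bids `b` such that every buyer would outbid all others with positive probability
by bidding `b`. -/
def winningBids {n : ℕ} (G : Fin n → PMF ℝ) (σ : Fin n → BidStrategy) : Set ℝ :=
  {b | 0 ≤ b ∧ ∀ i, 0 < profileLaw G σ {θ | ∀ j, j ≠ i → (θ j).2 < b}}

/-- The smallest winning bid (the least element of the closure of `winningBids`). -/
noncomputable def smallestWinningBid {n : ℕ} (G : Fin n → PMF ℝ) (σ : Fin n → BidStrategy) : ℝ :=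
  sInf (winningBids G σ)

/-- Two strategies of buyers with value distribution `G` are the same above the threshold `c`:
at every value they put the same probability on every set of bids above `c`, and at every
value larger than `c` they are the same distribution of bids. -/
def SameStrategyAbove (c : ℝ) (G : PMF ℝ) (s t : BidStrategy) : Prop :=
  ∀ v ∈ G.support,
    (s v : Measure ℝ).restrict (Set.Ioi c) = (t v : Measure ℝ).restrict (Set.Ioi c) ∧
    (c < v → s v = t v)

/-! Write F_k for the distribution function of buyer k's bid and W_i for the product of the F_k over
k ≠ i. In equilibrium almost every bid of buyer i at value v maximizes (v - b) * W_i(b): ties never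
pay more than this, and bids slightly above b approach it (`IsBNE.ae_mem_optimalBids`). Single
crossing then orders the bids of one buyer by value (`optimalBids_le_of_lt`), so a strict gap
between the bid laws of i and j at a single value forces a gap of the same sign between F_i and F_j
(`bidCdf_lt_bidCdf`).

It remains to exclude F_i < F_j at a point above the threshold (`bidCdf_le_bidCdf`). Follow the gap
up to the first c where it closes. Near c some value v shows the gap, and at v the bid c is optimal
for i, while some d < c with F_i(d) < F_j(d) is optimal for j. Revealed preference says that F_j /
F_i is at least as large at c as at d (`bidCdf_le_of_optimal`), yet it exceeds 1 at d and is at most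
1 at c. -/

open ProbabilityTheory Set Filter Topology

/-! ### Bid distributions and winning probabilities -/

section Laws

/-- The distribution function of the bid of a buyer with value distribution `G` and strategy `s`. -/
noncomputable def bidCdf (G : PMF ℝ) (s : BidStrategy) (b : ℝ) : ℝ :=
  (valueBidLaw G s).real {x | x.2 ≤ b}

theorem valueBidLaw_apply (G : PMF ℝ) (s : BidStrategy) {A : Set (ℝ × ℝ)} (hA : MeasurableSet A) :
    valueBidLaw G s A =
      ∑' v : G.support, G (v : ℝ) * (s (v : ℝ) : Measure ℝ) {b | ((v : ℝ), b) ∈ A} := by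
  rw [valueBidLaw, Measure.sum_apply _ hA]
  refine tsum_congr fun v => ?_
  rw [Measure.smul_apply, Measure.map_apply (by fun_prop) hA, smul_eq_mul]
  rfl

instance isProbabilityMeasure_valueBidLaw (G : PMF ℝ) (s : BidStrategy) :
    IsProbabilityMeasure (valueBidLaw G s) where
  measure_univ := by
    rw [valueBidLaw_apply G s MeasurableSet.univ]
    have h : ∀ v : G.support, G (v : ℝ) * (s (v : ℝ) : Measure ℝ)
        {b | ((v : ℝ), b) ∈ (univ : Set (ℝ × ℝ))} = G v := fun v => by simp
    simp_rw [h]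
    rw [tsum_subtype G.support G, show G.support.indicator G = G from Set.indicator_support]
    exact G.tsum_coe

instance isProbabilityMeasure_profileLaw {n : ℕ} (G : Fin n → PMF ℝ) (σ : Fin n → BidStrategy) :
    IsProbabilityMeasure (profileLaw G σ) := by
  unfold profileLaw; infer_instance

theorem bidCdf_eq_sum {G : PMF ℝ} (hG : G.support.Finite) (s : BidStrategy) (b : ℝ) :
    bidCdf G s b = ∑ v ∈ hG.toFinset, (G v).toReal * cdf (s v : Measure ℝ) b := by
  have hA : MeasurableSet {x : ℝ × ℝ | x.2 ≤ b} := measurableSet_le (by fun_prop) (by fun_prop)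
  rw [bidCdf, measureReal_def, valueBidLaw_apply G s hA]
  have := hG.fintype
  rw [tsum_fintype, ENNReal.toReal_sum
    (fun v _ => ENNReal.mul_ne_top (G.apply_ne_top _) (measure_ne_top _ _)),
    ← Finset.sum_subtype (hG.toFinset) (fun x => by simp)
      (fun v : ℝ => (G v * (s v : Measure ℝ) {b' | (v, b') ∈ {x : ℝ × ℝ | x.2 ≤ b}}).toReal)]
  refine Finset.sum_congr rfl fun v _ => ?_
  rw [ENNReal.toReal_mul, cdf_eq_real]
  rfl

theorem bidCdf_nonneg (G : PMF ℝ) (s : BidStrategy) (b : ℝ) : 0 ≤ bidCdf G s b :=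
  measureReal_nonneg

theorem monotone_bidCdf (G : PMF ℝ) (s : BidStrategy) : Monotone (bidCdf G s) :=
  fun _ _ hab => measureReal_mono fun _ hx => le_trans hx hab

theorem tendsto_bidCdf_right {G : PMF ℝ} (hG : G.support.Finite) (s : BidStrategy) (c : ℝ) :
    Tendsto (bidCdf G s) (𝓝[>] c) (𝓝 (bidCdf G s c)) := by
  rw [bidCdf_eq_sum hG, funext (bidCdf_eq_sum hG s)]
  refine tendsto_finsetSum _ fun v _ => Tendsto.const_mul _ ?_
  exact ((cdf (s v : Measure ℝ)).right_continuous c).mono Ioi_subset_Ici_self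

theorem ae_bid_le_value {G : PMF ℝ} {s : BidStrategy}
    (h : ∀ v ∈ G.support, AdmissibleBid v (s v)) : ∀ᵐ x ∂(valueBidLaw G s), x.2 ≤ x.1 := by
  have hA : MeasurableSet {x : ℝ × ℝ | ¬ x.2 ≤ x.1} :=
    (measurableSet_le measurable_snd measurable_fst).compl
  rw [ae_iff, valueBidLaw_apply G s hA, ENNReal.tsum_eq_zero]
  intro v
  have h0 : (s (v : ℝ) : Measure ℝ) {b | ((v : ℝ), b) ∈ {x : ℝ × ℝ | ¬ x.2 ≤ x.1}} = 0 :=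
    ae_iff.1 ((h v v.2).mono fun b hb => hb.2)
  rw [h0, mul_zero]

variable {n : ℕ} (G : Fin n → PMF ℝ) (σ : Fin n → BidStrategy)

/-- The probability that no buyer other than `i` bids more than `b`. -/
noncomputable def winProb (i : Fin n) (b : ℝ) : ℝ :=
  ∏ k ∈ Finset.univ.erase i, bidCdf (G k) (σ k) b

theorem profileLaw_real_le (i : Fin n) (b : ℝ) :
    (profileLaw G σ).real {θ | ∀ j, j ≠ i → (θ j).2 ≤ b} = winProb G σ i b := by
  have h : {θ : Fin n → ℝ × ℝ | ∀ j, j ≠ i → (θ j).2 ≤ b} =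
      univ.pi fun j => if j = i then univ else {x : ℝ × ℝ | x.2 ≤ b} := by
    ext θ
    simp only [Set.mem_ofPred_eq, Set.mem_pi, mem_univ, true_imp_iff]
    refine forall_congr' fun j => ?_
    by_cases hj : j = i <;> simp [hj]
  rw [h, measureReal_def, profileLaw, Measure.pi_pi, ENNReal.toReal_prod, winProb,
    ← Finset.mul_prod_erase _ _ (Finset.mem_univ i)]
  simp only [if_true, measure_univ, ENNReal.toReal_one, one_mul]
  refine Finset.prod_congr rfl fun j hj => ?_
  rw [if_neg (Finset.ne_of_mem_erase hj)]
  rfl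

theorem winProb_nonneg (i : Fin n) (b : ℝ) : 0 ≤ winProb G σ i b :=
  Finset.prod_nonneg fun _ _ => bidCdf_nonneg _ _ _

theorem monotone_winProb (i : Fin n) : Monotone (winProb G σ i) := fun _ _ hab =>
  Finset.prod_le_prod (fun _ _ => bidCdf_nonneg _ _ _) fun k _ => monotone_bidCdf (G k) (σ k) hab

theorem ae_profile_bid_le_value (h : ∀ i, ∀ v ∈ (G i).support, AdmissibleBid v (σ i v)) :
    ∀ᵐ θ ∂(profileLaw G σ), ∀ j, (θ j).2 ≤ (θ j).1 :=
  Measure.ae_le_pi (μ := fun i => valueBidLaw (G i) (σ i)) (f := fun _ x => x.2)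
    (f' := fun _ x => x.1) fun j => ae_bid_le_value (h j)

end Laws

/-! ### Expected utility and optimal bids -/

section Utility

variable {n : ℕ}

theorem measurable_exPostUtility (i : Fin n) (v : ℝ) :
    Measurable fun p : ℝ × (Fin n → ℝ × ℝ) => exPostUtility i v p.1 p.2 := by
  have hT : Measurable fun p : ℝ × (Fin n → ℝ × ℝ) => {j | j ≠ i ∧ (p.2 j).2 = p.1} := by
    rw [measurable_set_iff]
    intro j
    refine measurableSet_setOfPred.1 ?_
    refine MeasurableSet.inter (MeasurableSet.const _) ?_
    exact measurableSet_eq_fun (by fun_prop) (by fun_prop)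
  have hg : Measurable fun q : Set (Fin n) × (Fin n → ℝ × ℝ) =>
      sSup ((fun j => (q.2 j).1) '' q.1) := by
    -- The set of tied rivals takes finitely many values, so it may be fixed.
    refine measurable_from_prod_countable_right fun T => ?_
    simp only [sSup_image']
    exact Measurable.iSup fun j => by fun_prop
  have hs : Measurable fun p : ℝ × (Fin n → ℝ × ℝ) =>
      sSup ((fun j => (p.2 j).1) '' {j | j ≠ i ∧ (p.2 j).2 = p.1}) :=
    hg.comp (hT.prodMk measurable_snd)
  unfold exPostUtility
  refine Measurable.ite ?_ (by fun_prop) (Measurable.ite ?_ ?_ measurable_const)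
  · simp only [ofPred_forall]
    refine MeasurableSet.iInter fun j => MeasurableSet.iInter fun _ => ?_
    exact measurableSet_lt (by fun_prop) (by fun_prop)
  · simp only [ofPred_forall]
    refine MeasurableSet.iInter fun j => MeasurableSet.iInter fun _ => ?_
    exact measurableSet_le (by fun_prop) (by fun_prop)
  · exact measurable_const.max (measurable_const.sub hs)

theorem exPostUtility_nonneg (i : Fin n) {v b : ℝ} (hb : b ≤ v) (θ : Fin n → ℝ × ℝ) :
    0 ≤ exPostUtility i v b θ := by
  unfold exPostUtility
  split_ifs
  · linarith
  · exact le_max_left _ _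
  · exact le_rfl

/-- A tied winner pays at least the value of a tied rival, which is at least b because that rival
does not overbid. -/
theorem exPostUtility_le (i : Fin n) {v b : ℝ} (hb : b ≤ v) {θ : Fin n → ℝ × ℝ}
    (hθ : ∀ j, (θ j).2 ≤ (θ j).1) :
    exPostUtility i v b θ ≤ {θ | ∀ j, j ≠ i → (θ j).2 ≤ b}.indicator (fun _ => v - b) θ := by
  unfold exPostUtility
  split_ifs with h1 h2
  · rw [indicator_of_mem (show θ ∈ {θ : Fin n → ℝ × ℝ | ∀ j, j ≠ i → (θ j).2 ≤ b} from
      fun j hj => (h1 j hj).le)]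
  · rw [indicator_of_mem (show θ ∈ {θ : Fin n → ℝ × ℝ | ∀ j, j ≠ i → (θ j).2 ≤ b} from h2)]
    push Not at h1
    obtain ⟨j, hj, hbj⟩ := h1
    have hjb : (θ j).2 = b := le_antisymm (h2 j hj) hbj
    have : (θ j).1 ≤ sSup ((fun j => (θ j).1) '' {j | j ≠ i ∧ (θ j).2 = b}) :=
      le_csSup (toFinite _).bddAbove ⟨j, ⟨hj, hjb⟩, rfl⟩
    have := hθ j
    exact max_le (by linarith) (by linarith)
  · exact indicator_nonneg (fun _ _ => by linarith) _

variable (G : Fin n → PMF ℝ) (σ : Fin n → BidStrategy)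

theorem integrable_exPostUtility (h : ∀ i, ∀ v ∈ (G i).support, AdmissibleBid v (σ i v))
    (i : Fin n) {v b : ℝ} (hb : b ≤ v) :
    Integrable (fun θ => exPostUtility i v b θ) (profileLaw G σ) := by
  refine Integrable.of_bound (C := v - b)
    ((measurable_exPostUtility i v).comp (measurable_const.prodMk measurable_id)).aestronglyMeasurable
    ?_
  filter_upwards [ae_profile_bid_le_value G σ h] with θ hθ
  rw [Real.norm_of_nonneg (exPostUtility_nonneg i hb θ)]
  refine (exPostUtility_le i hb hθ).trans (indicator_le_self' (fun _ _ => by linarith) _)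

theorem integral_exPostUtility_nonneg (i : Fin n) {v b : ℝ} (hb : b ≤ v) :
    0 ≤ ∫ θ, exPostUtility i v b θ ∂(profileLaw G σ) :=
  integral_nonneg fun θ => exPostUtility_nonneg i hb θ

theorem measurableSet_others_le (i : Fin n) (b : ℝ) :
    MeasurableSet {θ : Fin n → ℝ × ℝ | ∀ j, j ≠ i → (θ j).2 ≤ b} := by
  simp only [ofPred_forall]
  refine MeasurableSet.iInter fun j => MeasurableSet.iInter fun _ => ?_
  exact measurableSet_le (by fun_prop) (by fun_prop)

theorem integral_exPostUtility_le (h : ∀ i, ∀ v ∈ (G i).support, AdmissibleBid v (σ i v))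
    (i : Fin n) {v b : ℝ} (hb : b ≤ v) :
    ∫ θ, exPostUtility i v b θ ∂(profileLaw G σ) ≤ (v - b) * winProb G σ i b := by
  calc ∫ θ, exPostUtility i v b θ ∂(profileLaw G σ)
      ≤ ∫ θ, {θ | ∀ j, j ≠ i → (θ j).2 ≤ b}.indicator (fun _ => v - b) θ ∂(profileLaw G σ) := by
        refine integral_mono_ae (integrable_exPostUtility G σ h i hb)
          ((integrable_const _).indicator (measurableSet_others_le i b)) ?_
        filter_upwards [ae_profile_bid_le_value G σ h] with θ hθ using exPostUtility_le i hb hθ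
    _ = (v - b) * winProb G σ i b := by
        rw [integral_indicator_const _ (measurableSet_others_le i b), profileLaw_real_le,
          smul_eq_mul, mul_comm]

theorem le_integral_exPostUtility (h : ∀ i, ∀ v ∈ (G i).support, AdmissibleBid v (σ i v))
    (i : Fin n) {v b b' : ℝ} (hbb : b < b') (hb : b' ≤ v) :
    (v - b') * winProb G σ i b ≤ ∫ θ, exPostUtility i v b' θ ∂(profileLaw G σ) := by
  calc (v - b') * winProb G σ i b
      = ∫ θ, {θ | ∀ j, j ≠ i → (θ j).2 ≤ b}.indicator (fun _ => v - b') θ ∂(profileLaw G σ) := by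
        rw [integral_indicator_const _ (measurableSet_others_le i b), profileLaw_real_le,
          smul_eq_mul, mul_comm]
    _ ≤ _ := by
        refine integral_mono ((integrable_const _).indicator (measurableSet_others_le i b))
          (integrable_exPostUtility G σ h i hb) fun θ => ?_
        refine indicator_apply_le' (fun hθ => ?_) fun _ => exPostUtility_nonneg i hb θ
        rw [exPostUtility, if_pos fun j hj => (hθ j hj).trans_lt hbb]

/-- The bids in `[0, v]` that maximize `(v - b) * winProb G σ i b`. -/
def optimalBids (i : Fin n) (v : ℝ) : Set ℝ :=
  {b | 0 ≤ b ∧ b ≤ v ∧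
    ∀ b', 0 ≤ b' → b' ≤ v → (v - b') * winProb G σ i b' ≤ (v - b) * winProb G σ i b}

variable {G σ}

/-- The equilibrium utility U bounds the utility of every pure deviation and is its average, so it
is attained almost surely. Perturbing bids upwards shows that U also bounds the tie-free payoff (v -
b) * W_i(b), which in turn dominates the true payoff. -/
theorem IsBNE.ae_mem_optimalBids (hσ : IsBNE G σ) (i : Fin n) {v : ℝ} (hv : v ∈ (G i).support)
    (hv0 : 0 ≤ v) : ∀ᵐ b ∂(σ i v : Measure ℝ), b ∈ optimalBids G σ i v := by
  set u : ℝ → ℝ := fun b => ∫ θ, exPostUtility i v b θ ∂(profileLaw G σ) with hu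
  set U : ℝ := ∫ b, u b ∂(σ i v : Measure ℝ) with hU
  have hadm := hσ.admissible i v hv
  have hle : ∀ b, 0 ≤ b → b ≤ v → u b ≤ U := fun b h0 hb => by
    have := hσ.best_response i v hv ⟨Measure.dirac b, inferInstance⟩
      ((ae_dirac_iff (measurableSet_Icc (a := 0) (b := v))).2 ⟨h0, hb⟩)
    simpa [interimUtility] using this
  have hmeas : StronglyMeasurable u :=
    (measurable_exPostUtility i v).stronglyMeasurable.integral_prod_right
  have hint : Integrable u (σ i v : Measure ℝ) := by
    refine Integrable.of_bound (C := U) hmeas.aestronglyMeasurable ?_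
    filter_upwards [hadm] with b hb
    rw [Real.norm_of_nonneg (integral_exPostUtility_nonneg G σ i hb.2)]
    exact hle b hb.1 hb.2
  have hzero : ∫ b, (U - u b) ∂(σ i v : Measure ℝ) = 0 := by
    rw [integral_sub (integrable_const _) hint]
    simp [hU]
  have hae : ∀ᵐ b ∂(σ i v : Measure ℝ), U - u b = 0 := by
    refine (integral_eq_zero_iff_of_nonneg_ae ?_ ((integrable_const U).sub hint)).1 hzero
    filter_upwards [hadm] with b hb
    exact sub_nonneg.2 (hle b hb.1 hb.2)
  have hdev : ∀ b, 0 ≤ b → b ≤ v → (v - b) * winProb G σ i b ≤ U := by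
    intro b h0 hb
    rcases hb.eq_or_lt with rfl | hlt
    -- At b = v there is no room to bid higher, but the bound is zero.
    · rw [sub_self, zero_mul]
      exact (integral_exPostUtility_nonneg G σ i le_rfl).trans (hle _ h0 le_rfl)
    · have ht : Tendsto (fun b' => (v - b') * winProb G σ i b) (𝓝[>] b)
          (𝓝 ((v - b) * winProb G σ i b)) :=
        (Continuous.tendsto (by fun_prop) b).mono_left nhdsWithin_le_nhds
      refine le_of_tendsto ht ?_
      filter_upwards [Ioo_mem_nhdsGT hlt] with b' hb'
      exact (le_integral_exPostUtility G σ hσ.admissible i hb'.1 hb'.2.le).trans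
        (hle b' (h0.trans hb'.1.le) hb'.2.le)
  filter_upwards [hadm, hae] with b hb hUb
  refine ⟨hb.1, hb.2, fun b' h0 hb' => (hdev b' h0 hb').trans ?_⟩
  have := integral_exPostUtility_le G σ hσ.admissible i hb.2
  change u b ≤ _ at this
  linarith

end Utility

/-! ### Structure of equilibrium bids -/

section Core

theorem exists_mem_Ioc_of_measure_ne_zero {μ : Measure ℝ} {K : Set ℝ} (hK : ∀ᵐ b ∂μ, b ∈ K)
    {x c : ℝ}
    (h : μ (Ioc x c) ≠ 0) : ∃ b ∈ K, x < b ∧ b ≤ c := by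
  obtain ⟨b, hb, hbK⟩ := Measure.exists_mem_of_measure_ne_zero_of_ae h (ae_restrict_of_ae hK)
  exact ⟨b, hbK, hb.1, hb.2⟩

theorem exists_mem_le_of_cdf_pos {μ : Measure ℝ} [IsProbabilityMeasure μ] {K : Set ℝ}
    (hK : ∀ᵐ b ∂μ, b ∈ K) {c : ℝ} (h : 0 < cdf μ c) : ∃ b ∈ K, b ≤ c := by
  rw [cdf_eq_real] at h
  have h0 : μ (Iic c) ≠ 0 := fun h0 => by simp [measureReal_def, h0] at h
  obtain ⟨b, hb, hbK⟩ := Measure.exists_mem_of_measure_ne_zero_of_ae h0 (ae_restrict_of_ae hK)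
  exact ⟨b, hbK, hb⟩

theorem cdf_eq_one_of_ae_le {μ : Measure ℝ} [IsProbabilityMeasure μ] {c : ℝ}
    (h : ∀ᵐ b ∂μ, b ≤ c) : cdf μ c = 1 := by
  rw [cdf_eq_real, measureReal_def, (mem_ae_iff_prob_eq_one measurableSet_Iic).1 h,
    ENNReal.toReal_one]

theorem measure_Ioc_ne_zero_of_cdf_lt {μ : Measure ℝ} [IsProbabilityMeasure μ] {x c : ℝ}
    (h : cdf μ x < cdf μ c) : μ (Ioc x c) ≠ 0 := by
  intro h0
  rw [← measure_cdf μ, StieltjesFunction.measure_Ioc, ENNReal.ofReal_eq_zero] at h0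
  linarith

variable {n : ℕ} {G : Fin n → PMF ℝ} {σ : Fin n → BidStrategy}

/-- Optimality passes to limits from below: since W_i is monotone, its value at c dominates its
values at the approximating bids. -/
theorem mem_optimalBids_of_measure_Ioc {i : Fin n} {v : ℝ} {μ : Measure ℝ}
    (hK : ∀ᵐ b ∂μ, b ∈ optimalBids G σ i v) {c : ℝ} (h : ∀ x < c, μ (Ioc x c) ≠ 0) :
    c ∈ optimalBids G σ i v := by
  have hx : ∀ x < c, ∃ b ∈ optimalBids G σ i v, x < b ∧ b ≤ c := fun x hxc =>
    exists_mem_Ioc_of_measure_ne_zero hK (h x hxc)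
  obtain ⟨b₀, hb₀, -, hb₀c⟩ := hx (c - 1) (by linarith)
  have hcv : c ≤ v := le_of_forall_lt fun x hxc => by
    obtain ⟨b, hb, hxb, -⟩ := hx x hxc
    exact hxb.trans_le hb.2.1
  refine ⟨hb₀.1.trans hb₀c, hcv, fun b' h0 hb' => ?_⟩
  have ht : Tendsto (fun x => (v - x) * winProb G σ i c) (𝓝[<] c)
      (𝓝 ((v - c) * winProb G σ i c)) :=
    (Continuous.tendsto (by fun_prop) c).mono_left nhdsWithin_le_nhds
  refine ge_of_tendsto ht ?_
  filter_upwards [self_mem_nhdsWithin] with x hxc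
  obtain ⟨b, hb, hxb, hbc⟩ := hx x hxc
  calc (v - b') * winProb G σ i b' ≤ (v - b) * winProb G σ i b := hb.2.2 b' h0 hb'
    _ ≤ (v - b) * winProb G σ i c :=
        mul_le_mul_of_nonneg_left (monotone_winProb G σ i hbc) (by linarith [hb.2.1])
    _ ≤ (v - x) * winProb G σ i c :=
        mul_le_mul_of_nonneg_right (by linarith) (winProb_nonneg G σ i c)

theorem optimalBids_le_of_lt {i : Fin n} {u v x y : ℝ} (huv : u < v)
    (hx : x ∈ optimalBids G σ i u) (hy : y ∈ optimalBids G σ i v)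
    (hpos : 0 < (v - y) * winProb G σ i y) : x ≤ y := by
  by_contra! hyx
  have h1 := hx.2.2 y hy.1 (hyx.le.trans hx.2.1)
  have h2 := hy.2.2 x hx.1 (hx.2.1.trans huv.le)
  have h3 := monotone_winProb G σ i hyx.le
  have hy0 : 0 < winProb G σ i y := pos_of_mul_pos_right hpos (by linarith [hy.2.1])
  -- The sum of the two optimality inequalities bounds W_i(x) by W_i(y). With equal winning chances,
  -- the cheaper bid y would be strictly better at u.
  have h4 : winProb G σ i x = winProb G σ i y := by
    refine le_antisymm (le_of_mul_le_mul_left ?_ (sub_pos.2 huv)) h3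
    linarith
  rw [h4] at h1
  linarith [mul_pos (sub_pos.2 hyx) hy0]

theorem mem_winningBids_of_bidCdf_pos {y b : ℝ} (hy : 0 ≤ y) (hyb : y < b)
    (h : ∀ k, 0 < bidCdf (G k) (σ k) y) : b ∈ winningBids G σ := by
  refine ⟨hy.trans hyb.le, fun i => ?_⟩
  have h1 : 0 < (profileLaw G σ).real {θ | ∀ j, j ≠ i → (θ j).2 ≤ y} := by
    rw [profileLaw_real_le]
    exact Finset.prod_pos fun k _ => h k
  have h2 := (ENNReal.toReal_pos_iff.1 h1).1
  exact h2.trans_le (measure_mono fun θ hθ j hj => (hθ j hj).trans_lt hyb)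

theorem smallestWinningBid_le {y : ℝ} (hy : 0 ≤ y) (h : ∀ k, 0 < bidCdf (G k) (σ k) y) :
    smallestWinningBid G σ ≤ y :=
  le_of_forall_gt_imp_ge_of_dense fun _ hb =>
    csInf_le ⟨0, fun _ hx => hx.1⟩ (mem_winningBids_of_bidCdf_pos hy hb h)

theorem smallestWinningBid_nonneg : 0 ≤ smallestWinningBid G σ :=
  Real.sInf_nonneg fun _ hx => hx.1

theorem bidCdf_eq_one (hσ : IsBNE G σ) {i : Fin n} {b : ℝ}
    (hb : ∀ v ∈ (G i).support, v ≤ b) : bidCdf (G i) (σ i) b = 1 := by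
  have : ∀ᵐ x ∂(valueBidLaw (G i) (σ i)), x ∈ {x : ℝ × ℝ | x.2 ≤ b} := by
    have hA : MeasurableSet {x : ℝ × ℝ | ¬ x.2 ≤ b} :=
      (measurableSet_le measurable_snd measurable_const).compl
    refine ae_iff.2 ?_
    refine (valueBidLaw_apply (G i) (σ i) hA).trans (ENNReal.tsum_eq_zero.2 fun v => ?_)
    rw [mul_eq_zero]
    exact Or.inr (ae_iff.1 ((hσ.admissible i v v.2).mono fun x hx => hx.2.trans (hb v v.2)))
  rw [bidCdf, measureReal_def, (mem_ae_iff_prob_eq_one (measurableSet_le measurable_snd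
    measurable_const)).1 this, ENNReal.toReal_one]

theorem winningBids_nonempty (hfin : ∀ i, (G i).support.Finite) (hσ : IsBNE G σ) :
    (winningBids G σ).Nonempty := by
  obtain ⟨M, hM⟩ := (finite_iUnion hfin).bddAbove
  refine ⟨max M 0 + 1, mem_winningBids_of_bidCdf_pos (le_max_right M 0) (lt_add_one _) fun k => ?_⟩
  rw [bidCdf_eq_one hσ fun v hv => (hM (mem_iUnion.2 ⟨k, hv⟩)).trans (le_max_left M 0)]
  exact one_pos

/-- With at least two buyers, every k is a rival of some l, and l can win below b only if k bids
below b with positive probability. -/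
theorem bidCdf_pos (hfin : ∀ i, (G i).support.Finite) (hσ : IsBNE G σ) {i j : Fin n} (hij : i ≠ j)
    {b : ℝ} (hb : smallestWinningBid G σ < b) (k : Fin n) : 0 < bidCdf (G k) (σ k) b := by
  obtain ⟨b', hb', hlt⟩ := exists_lt_of_csInf_lt (winningBids_nonempty hfin hσ) hb
  obtain ⟨l, hl⟩ : ∃ l, k ≠ l := by
    by_cases h : k = i
    · exact ⟨j, h ▸ hij⟩
    · exact ⟨i, h⟩
  have h1 : 0 < (profileLaw G σ).real {θ | ∀ j, j ≠ l → (θ j).2 ≤ b} :=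
    ENNReal.toReal_pos ((hb'.2 l).trans_le
      (measure_mono fun θ hθ j hj => (hθ j hj).le.trans hlt.le)).ne' (measure_ne_top _ _)
  rw [profileLaw_real_le] at h1
  refine (bidCdf_nonneg _ _ _).lt_of_ne' fun h0 => h1.ne' ?_
  exact Finset.prod_eq_zero (Finset.mem_erase.2 ⟨hl, Finset.mem_univ k⟩) h0

theorem utility_pos (hfin : ∀ i, (G i).support.Finite) (hσ : IsBNE G σ) {i j : Fin n}
    (hij : i ≠ j) (k : Fin n) {v y : ℝ} (hv : smallestWinningBid G σ < v)
    (hy : y ∈ optimalBids G σ k v) : 0 < (v - y) * winProb G σ k y := by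
  obtain ⟨b, hb1, hb2⟩ := exists_between hv
  refine lt_of_lt_of_le ?_ (hy.2.2 b (smallestWinningBid_nonneg.trans hb1.le) hb2.le)
  exact mul_pos (sub_pos.2 hb2) (Finset.prod_pos fun l _ => bidCdf_pos hfin hσ hij hb1 l)

/-- Lower values bid below higher values. -/
theorem cdf_eq_one_of_lt (hfin : ∀ i, (G i).support.Finite)
    (hnonneg : ∀ i, ∀ v ∈ (G i).support, 0 ≤ v) (hσ : IsBNE G σ) {i j : Fin n} (hij : i ≠ j)
    {k : Fin n} {u v b : ℝ} (hu : u ∈ (G k).support) (hv : v ∈ (G k).support) (huv : u < v)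
    (hlt : smallestWinningBid G σ < v) (h : 0 < cdf (σ k v : Measure ℝ) b) :
    cdf (σ k u : Measure ℝ) b = 1 := by
  obtain ⟨y, hy, hyb⟩ := exists_mem_le_of_cdf_pos (hσ.ae_mem_optimalBids k hv (hnonneg k v hv)) h
  refine cdf_eq_one_of_ae_le ((hσ.ae_mem_optimalBids k hu (hnonneg k u hu)).mono fun x hx => ?_)
  exact (optimalBids_le_of_lt huv hx hy (utility_pos hfin hσ hij k hlt hy)).trans hyb

/-- By the ordering of bids, j surely bids at most b at values below v, and i surely bids more than
b at values above v. Hence no other value offsets the gap at v. -/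
theorem bidCdf_lt_bidCdf (hfin : ∀ i, (G i).support.Finite)
    (hnonneg : ∀ i, ∀ v ∈ (G i).support, 0 ≤ v) (hσ : IsBNE G σ) {i j : Fin n} (hij : i ≠ j)
    (hG : G i = G j) {v b : ℝ} (hv : v ∈ (G i).support) (hlt : smallestWinningBid G σ < v)
    (h : cdf (σ i v : Measure ℝ) b < cdf (σ j v : Measure ℝ) b) :
    bidCdf (G i) (σ i) b < bidCdf (G j) (σ j) b := by
  rw [← hG, bidCdf_eq_sum (hfin i), bidCdf_eq_sum (hfin i)]
  refine Finset.sum_lt_sum (fun u hu => ?_) ⟨v, (hfin i).mem_toFinset.2 hv, ?_⟩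
  · refine mul_le_mul_of_nonneg_left ?_ ENNReal.toReal_nonneg
    have hu' : u ∈ (G i).support := (hfin i).mem_toFinset.1 hu
    rcases lt_trichotomy u v with huv | rfl | hvu
    · rw [cdf_eq_one_of_lt hfin hnonneg hσ hij (k := j) (hG ▸ hu') (hG ▸ hv) huv hlt
        ((cdf_nonneg _ _).trans_lt h)]
      exact cdf_le_one _ _
    · exact h.le
    · rcases (cdf_nonneg (σ i u : Measure ℝ) b).eq_or_lt with h0 | hpos
      · rw [← h0]
        exact cdf_nonneg _ _
      · have := cdf_eq_one_of_lt hfin hnonneg hσ hij hv hu' hvu (hlt.trans hvu) hpos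
        linarith [cdf_le_one (σ j v : Measure ℝ) b]
  · exact mul_lt_mul_of_pos_left h (ENNReal.toReal_pos hv ((G i).apply_ne_top v))

theorem lt_value_of_cdf_lt_one (hσ : IsBNE G σ) {i : Fin n} {v b : ℝ} (hv : v ∈ (G i).support)
    (h : cdf (σ i v : Measure ℝ) b < 1) : b < v := by
  by_contra! hvb
  exact h.ne (cdf_eq_one_of_ae_le ((hσ.admissible i v hv).mono fun x hx => hx.2.trans hvb))

theorem winProb_eq_mul {i j : Fin n} (hij : i ≠ j) (b : ℝ) : winProb G σ i b =
    bidCdf (G j) (σ j) b *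
      ∏ k ∈ (Finset.univ.erase i).erase j, bidCdf (G k) (σ k) b :=
  (Finset.mul_prod_erase _ _ (Finset.mem_erase.2 ⟨hij.symm, Finset.mem_univ j⟩)).symm

/-- Multiply "i weakly prefers c to d" by "j weakly prefers d to c": the margins and the factors of
the remaining buyers cancel. -/
theorem bidCdf_le_of_optimal {i j : Fin n} (hij : i ≠ j) {v c d : ℝ} (hdc : d ≤ c)
    (hc : c ∈ optimalBids G σ i v) (hd : d ∈ optimalBids G σ j v)
    (hcpos : 0 < (v - c) * winProb G σ i c) (hdpos : 0 < (v - d) * winProb G σ j d) :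
    bidCdf (G j) (σ j) d * bidCdf (G i) (σ i) c ≤
      bidCdf (G j) (σ j) c * bidCdf (G i) (σ i) d := by
  have h1 := hc.2.2 d hd.1 hd.2.1
  have h2 := hd.2.2 c hc.1 hc.2.1
  have hvc : 0 < v - c := pos_of_mul_pos_left hcpos (winProb_nonneg G σ i c)
  have hvd : 0 < v - d := by linarith
  have h3 := mul_le_mul h1 h2 (mul_nonneg hvc.le (winProb_nonneg G σ j c)) hcpos.le
  rw [winProb_eq_mul hij] at hcpos h3
  rw [winProb_eq_mul hij.symm] at hdpos h3
  rw [winProb_eq_mul hij, winProb_eq_mul hij.symm, Finset.erase_right_comm (a := j)] at h3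
  rw [Finset.erase_right_comm] at hdpos
  set R : ℝ → ℝ := fun b => ∏ k ∈ (Finset.univ.erase i).erase j, bidCdf (G k) (σ k) b with hR
  change 0 < (v - c) * (_ * R c) at hcpos
  change 0 < (v - d) * (_ * R d) at hdpos
  have hRc : 0 < R c := pos_of_mul_pos_right (pos_of_mul_pos_right hcpos hvc.le)
    (bidCdf_nonneg _ _ _)
  have hRd : 0 < R d := pos_of_mul_pos_right (pos_of_mul_pos_right hdpos hvd.le)
    (bidCdf_nonneg _ _ _)
  have hpos : 0 < (v - c) * (v - d) * (R c * R d) := by positivity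
  refine le_of_mul_le_mul_left ?_ hpos
  change (v - d) * (_ * R d) * ((v - c) * (_ * R c)) ≤
    (v - c) * (_ * R c) * ((v - d) * (_ * R d)) at h3
  linarith

theorem bidCdf_le_bidCdf (hfin : ∀ i, (G i).support.Finite)
    (hnonneg : ∀ i, ∀ v ∈ (G i).support, 0 ≤ v) (hσ : IsBNE G σ) {i j : Fin n} (hij : i ≠ j)
    (hG : G i = G j) {b₀ : ℝ} (hb₀ : smallestWinningBid G σ < b₀) :
    bidCdf (G j) (σ j) b₀ ≤ bidCdf (G i) (σ i) b₀ := by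
  by_contra! hlt₀
  set A : Set ℝ := {b | b₀ ≤ b ∧ bidCdf (G j) (σ j) b ≤ bidCdf (G i) (σ i) b} with hA
  have hAne : A.Nonempty := by
    obtain ⟨M, hM⟩ := (hfin i).bddAbove
    have hM' : ∀ v ∈ (G i).support, v ≤ max b₀ M := fun v hv => (hM hv).trans (le_max_right _ _)
    refine ⟨max b₀ M, le_max_left _ _, ?_⟩
    rw [bidCdf_eq_one hσ hM', bidCdf_eq_one hσ (hG ▸ hM')]
  have hAbdd : BddBelow A := ⟨b₀, fun b hb => hb.1⟩
  set c : ℝ := sInf A with hc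
  have hcA : bidCdf (G j) (σ j) c ≤ bidCdf (G i) (σ i) c := by
    by_contra! hlt
    have hev : ∀ᶠ b in 𝓝[>] c, bidCdf (G i) (σ i) b < bidCdf (G j) (σ j) b :=
      (tendsto_bidCdf_right (hfin i) (σ i) c).eventually_lt
        (tendsto_bidCdf_right (hfin j) (σ j) c) hlt
    obtain ⟨d, hcd, hd⟩ := (mem_nhdsGT_iff_exists_Ioo_subset).1 hev
    obtain ⟨b, hb, hbd⟩ := exists_lt_of_csInf_lt hAne (show sInf A < d from hcd)
    rcases (csInf_le hAbdd hb).eq_or_lt with h | h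
    · rw [hc, h] at hlt
      exact absurd hb.2 (not_le.2 hlt)
    · exact absurd hb.2 (not_le.2 (hd ⟨h, hbd⟩))
  have hb₀c : b₀ < c := by
    refine (le_csInf hAne fun b hb => hb.1).lt_of_ne fun h => ?_
    exact absurd hcA (not_le.2 (hc.trans h.symm ▸ hlt₀))
  have hIco : ∀ b, b₀ ≤ b → b < c → bidCdf (G i) (σ i) b < bidCdf (G j) (σ j) b := by
    intro b h0 hbc
    by_contra! hle
    exact absurd (csInf_le hAbdd (show b ∈ A from ⟨h0, hle⟩)) (not_le.2 hbc)
  -- The support is finite, so one value carries the gap at bids arbitrarily close to c from the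
  -- left.
  obtain ⟨v, hv, hfreq⟩ : ∃ v ∈ (G i).support,
      ∃ᶠ b in 𝓝[<] c, cdf (σ i v : Measure ℝ) b < cdf (σ j v : Measure ℝ) b := by
    by_contra! hcon
    have hev : ∀ᶠ b in 𝓝[<] c, ∀ v ∈ (G i).support,
        cdf (σ j v : Measure ℝ) b ≤ cdf (σ i v : Measure ℝ) b := by
      rw [eventually_all_finite (hfin i)]
      exact fun v hv => hcon v hv
    obtain ⟨b, hb, hb0, hbc⟩ := (hev.and (Ioo_mem_nhdsLT hb₀c)).exists
    refine absurd (hIco b hb0.le hbc) (not_lt.2 ?_)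
    rw [← hG, bidCdf_eq_sum (hfin i), bidCdf_eq_sum (hfin i)]
    exact Finset.sum_le_sum fun u hu =>
      mul_le_mul_of_nonneg_left (hb u ((hfin i).mem_toFinset.1 hu)) ENNReal.toReal_nonneg
  have hx : ∀ x < c, ∃ b, x < b ∧ b₀ < b ∧ b < c ∧
      cdf (σ i v : Measure ℝ) b < cdf (σ j v : Measure ℝ) b := by
    intro x hxc
    obtain ⟨b, hb, hbm⟩ := (hfreq.and_eventually (Ioo_mem_nhdsLT (max_lt hxc hb₀c))).exists
    exact ⟨b, (le_max_left _ _).trans_lt hbm.1, (le_max_right _ _).trans_lt hbm.1, hbm.2, hb⟩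
  obtain ⟨b, -, hb0, hbc, hb⟩ := hx b₀ hb₀c
  have hbv : b < v := lt_value_of_cdf_lt_one hσ hv (hb.trans_le (cdf_le_one _ _))
  have hltv : smallestWinningBid G σ < v := hb₀.trans (hb0.trans hbv)
  have hvj : v ∈ (G j).support := hG ▸ hv
  have haei := hσ.ae_mem_optimalBids i hv (hnonneg i v hv)
  have haej := hσ.ae_mem_optimalBids j hvj (hnonneg j v hvj)
  have hcle : cdf (σ j v : Measure ℝ) c ≤ cdf (σ i v : Measure ℝ) c := by
    by_contra! h
    exact absurd hcA (not_le.2 (bidCdf_lt_bidCdf hfin hnonneg hσ hij hG hv hltv h))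
  have hcopt : c ∈ optimalBids G σ i v := by
    refine mem_optimalBids_of_measure_Ioc haei fun x hxc => measure_Ioc_ne_zero_of_cdf_lt ?_
    obtain ⟨b', hxb', -, hb'c, hb'⟩ := hx x hxc
    exact ((monotone_cdf _ hxb'.le).trans_lt hb').trans_le
      ((monotone_cdf _ hb'c.le).trans hcle)
  set q : ℝ := cdf (σ j v : Measure ℝ) b with hq
  have hqpos : 0 < q := (cdf_nonneg _ _).trans_lt hb
  -- d is the q-quantile of j's bid at v: j has mass immediately up to d, which makes d optimal, and
  -- F_i < F_j persists there.
  obtain ⟨d, hdb, hdq, hdmin⟩ : ∃ d ≤ b, cdf (σ j v : Measure ℝ) d = q ∧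
      ∀ x < d, cdf (σ j v : Measure ℝ) x < q := by
    set B : Set ℝ := {x | q ≤ cdf (σ j v : Measure ℝ) x} with hB
    have hbB : b ∈ B := le_refl q
    have hBbdd : BddBelow B := ⟨0, fun x hx => by
      obtain ⟨y, hy, hyx⟩ := exists_mem_le_of_cdf_pos haej (hqpos.trans_le hx)
      exact hy.1.trans hyx⟩
    have hdb : sInf B ≤ b := csInf_le hBbdd hbB
    refine ⟨sInf B, hdb, le_antisymm (monotone_cdf _ hdb) ?_, fun x hxd => ?_⟩
    · have ht := ((cdf (σ j v : Measure ℝ)).right_continuous (sInf B)).mono Ioi_subset_Ici_self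
      refine ge_of_tendsto ht ?_
      filter_upwards [self_mem_nhdsWithin] with x hx
      obtain ⟨y, hy, hyx⟩ := exists_lt_of_csInf_lt ⟨b, hbB⟩ (show sInf B < x from hx)
      exact le_trans hy (monotone_cdf _ hyx.le)
    · by_contra! h
      exact absurd (csInf_le hBbdd h) (not_le.2 hxd)
  have hdopt : d ∈ optimalBids G σ j v :=
    mem_optimalBids_of_measure_Ioc haej fun x hxd =>
      measure_Ioc_ne_zero_of_cdf_lt ((hdmin x hxd).trans_eq hdq.symm)
  have hFd : bidCdf (G i) (σ i) d < bidCdf (G j) (σ j) d := by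
    refine bidCdf_lt_bidCdf hfin hnonneg hσ hij hG hv hltv ?_
    rw [hdq]
    exact (monotone_cdf _ hdb).trans_lt hb
  have key := bidCdf_le_of_optimal hij (hdb.trans hbc.le) hcopt hdopt
    (utility_pos hfin hσ hij i hltv hcopt) (utility_pos hfin hσ hij j hltv hdopt)
  have hcpos := bidCdf_pos hfin hσ hij (hb₀.trans hb₀c) j
  nlinarith [mul_lt_mul_of_pos_left hFd hcpos,
    mul_le_mul_of_nonneg_left hcA (bidCdf_nonneg (G j) (σ j) d)]

theorem cdf_le_cdf (hfin : ∀ i, (G i).support.Finite)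
    (hnonneg : ∀ i, ∀ v ∈ (G i).support, 0 ≤ v) (hσ : IsBNE G σ) {i j : Fin n} (hij : i ≠ j)
    (hG : G i = G j) {v b : ℝ} (hv : v ∈ (G i).support) (hb : smallestWinningBid G σ < b) :
    cdf (σ j v : Measure ℝ) b ≤ cdf (σ i v : Measure ℝ) b := by
  by_contra! h
  have hbv : b < v := lt_value_of_cdf_lt_one hσ hv (h.trans_le (cdf_le_one _ _))
  exact absurd (bidCdf_le_bidCdf hfin hnonneg hσ hij hG hb)
    (not_le.2 (bidCdf_lt_bidCdf hfin hnonneg hσ hij hG hv (hb.trans hbv) h))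

theorem cdf_eq_cdf (hfin : ∀ i, (G i).support.Finite)
    (hnonneg : ∀ i, ∀ v ∈ (G i).support, 0 ≤ v) (hσ : IsBNE G σ) {i j : Fin n} (hij : i ≠ j)
    (hG : G i = G j) {v b : ℝ} (hv : v ∈ (G i).support) (hb : smallestWinningBid G σ ≤ b) :
    cdf (σ i v : Measure ℝ) b = cdf (σ j v : Measure ℝ) b := by
  have hti := ((cdf (σ i v : Measure ℝ)).right_continuous b).mono Ioi_subset_Ici_self
  have htj := ((cdf (σ j v : Measure ℝ)).right_continuous b).mono Ioi_subset_Ici_self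
  refine tendsto_nhds_unique_of_eventuallyEq hti htj ?_
  filter_upwards [self_mem_nhdsWithin] with x hx
  have hx' : smallestWinningBid G σ < x := hb.trans_lt hx
  exact le_antisymm (cdf_le_cdf hfin hnonneg hσ hij.symm hG.symm (hG ▸ hv) hx')
    (cdf_le_cdf hfin hnonneg hσ hij hG hv hx')

/-- An optimal bid at a value above the threshold earns a positive payoff, so every rival bids at
most b with positive probability. As k does too, the threshold would be at most b. -/
theorem cdf_eq_zero_of_lt (hfin : ∀ i, (G i).support.Finite)
    (hnonneg : ∀ i, ∀ v ∈ (G i).support, 0 ≤ v) (hσ : IsBNE G σ) {i j : Fin n} (hij : i ≠ j)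
    {k : Fin n} {v b : ℝ} (hv : v ∈ (G k).support) (hlt : smallestWinningBid G σ < v)
    (hb : b < smallestWinningBid G σ) : cdf (σ k v : Measure ℝ) b = 0 := by
  by_contra h0
  have hpos : 0 < cdf (σ k v : Measure ℝ) b := (cdf_nonneg _ _).lt_of_ne' h0
  obtain ⟨y, hy, hyb⟩ := exists_mem_le_of_cdf_pos (hσ.ae_mem_optimalBids k hv (hnonneg k v hv)) hpos
  refine absurd (smallestWinningBid_le (hy.1.trans hyb) fun l => ?_) (not_le.2 hb)
  by_cases hl : l = k
  · subst hl
    rw [bidCdf_eq_sum (hfin l)]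
    refine Finset.sum_pos' (fun u _ => mul_nonneg ENNReal.toReal_nonneg (cdf_nonneg _ _))
      ⟨v, (hfin l).mem_toFinset.2 hv, mul_pos (ENNReal.toReal_pos hv ((G l).apply_ne_top v)) hpos⟩
  · have hw : 0 < winProb G σ k y :=
      pos_of_mul_pos_right (utility_pos hfin hσ hij k hlt hy) (by linarith [hy.2.1])
    refine (bidCdf_nonneg _ _ _).lt_of_ne' fun h => (hw.trans_le (monotone_winProb G σ k hyb)).ne' ?_
    exact Finset.prod_eq_zero (Finset.mem_erase.2 ⟨hl, Finset.mem_univ l⟩) h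

theorem restrict_Ioi_eq_of_cdf_eq {μ ν : Measure ℝ} [IsProbabilityMeasure μ]
    [IsProbabilityMeasure ν] {c : ℝ} (h : ∀ b, c ≤ b → cdf μ b = cdf ν b) :
    μ.restrict (Ioi c) = ν.restrict (Ioi c) := by
  refine Measure.ext_of_Iic _ _ fun a => ?_
  rw [Measure.restrict_apply measurableSet_Iic, Measure.restrict_apply measurableSet_Iic,
    inter_comm, Ioi_inter_Iic, ← measure_cdf μ, ← measure_cdf ν, StieltjesFunction.measure_Ioc,
    StieltjesFunction.measure_Ioc]
  rcases le_total a c with hac | hca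
  · rw [ENNReal.ofReal_of_nonpos (sub_nonpos.2 (monotone_cdf _ hac)),
      ENNReal.ofReal_of_nonpos (sub_nonpos.2 (monotone_cdf _ hac))]
  · rw [h a hca, h c le_rfl]

theorem sameStrategyAbove_of_eq (hfin : ∀ i, (G i).support.Finite)
    (hnonneg : ∀ i, ∀ v ∈ (G i).support, 0 ≤ v) (hσ : IsBNE G σ) {i j : Fin n} (hG : G i = G j) :
    SameStrategyAbove (smallestWinningBid G σ) (G i) (σ i) (σ j) := by
  by_cases hij : i = j
  · subst hij
    exact fun v _ => ⟨rfl, fun _ => rfl⟩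
  intro v hv
  refine ⟨restrict_Ioi_eq_of_cdf_eq fun b hb => cdf_eq_cdf hfin hnonneg hσ hij hG hv hb,
    fun hlt => Subtype.ext (Measure.eq_of_cdf (σ i v : Measure ℝ) (σ j v : Measure ℝ)
      (StieltjesFunction.ext fun b => ?_))⟩
  rcases le_or_gt (smallestWinningBid G σ) b with hb | hb
  · exact cdf_eq_cdf hfin hnonneg hσ hij hG hv hb
  · exact (cdf_eq_zero_of_lt hfin hnonneg hσ hij hv hlt hb).trans
      (cdf_eq_zero_of_lt hfin hnonneg hσ hij (hG ▸ hv) hlt hb).symm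

end Core

theorem mainTheorem11 {n : ℕ} (G : Fin n → PMF ℝ)
    (hfin : ∀ i, (G i).support.Finite)
    (hnonneg : ∀ i, ∀ v ∈ (G i).support, 0 ≤ v)
    (σ : Fin n → BidStrategy) (hσ : IsBNE G σ) :
    (∀ i j, G i = G j →
      SameStrategyAbove (smallestWinningBid G σ) (G i) (σ i) (σ j)) ∧
    ((∀ i j, G i = G j) →
      ∀ i j, SameStrategyAbove (smallestWinningBid G σ) (G i) (σ i) (σ j)) :=
  ⟨fun _ _ h => sameStrategyAbove_of_eq hfin hnonneg hσ h,
    fun h i j => sameStrategyAbove_of_eq hfin hnonneg hσ (h i j)⟩
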